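/- **Model.** There are $N$ players and $K$ arms, $2\le N\le K$, and rounds $t=1,\dots,T$. In round $t$ a set $\mathcal P_t$ of players and a set $\mathcal A_t$ of arms are available; every arm $a_j\in\mathcal A_t$ has a known strict ranking of the players and a known capacity $c_j(t)$. A policy (possibly randomized) assigns each $p_i\in\mathcal P_t$ to an arm of $\mathcal A_t$ or leaves it unmatched, at most $c_j(t)$ players being assigned to $a_j$; its choice depends on the availabilities, rankings and capacities up to round $t$ and on the earlier matchings and rewards. If $p_i$ is assigned to $a_j$ it receives an independent Bernoulli reward of unknown mean $\mu_{i,j}\in(0,1)$; the reward is $0$ if it is unmatched. For each player, arms available in the same round have distinct means. Let $T_i$ be the number of rounds in which $p_i$ is available, let $\overline m_t$ and $\underline m_t$ be the player-optimal and the player-pessimal stable matching of round $t$ for the true means, put $\mu_{i,0}=0$ (where $0$ stands for "unmatched"), and let $$\overline R_i(T_i)=\sum_{t:\,p_i\in\mathcal P_t}\bigl(\mu_{i,\overline m_t(i)}-\mathbb E[r_i(t)]\bigr),\qquad \underline R_i(T_i)=\sum_{t:\,p_i\in\mathcal P_t}\bigl(\mu_{i,\underline m_t(i)}-\mathbb E[r_i(t)]\bigr),$$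 where $r_i(t)$ is the reward of $p_i$ in round $t$. Let $\Delta$ be the minimum of $|\mu_{i,j}-\mu_{i,j'}|$ over all rounds $t$, all $p_i\in\mathcal P_t$ and all distinct $a_j,a_{j'}\in\mathcal A_t$. **Asymptotics.** Let $T\to\infty$ with $N$ fixed, while $K=K_T\ge N$ may depend on $T$; the policy may depend on $K_T$ and $T$. A *problem instance* consists, for every $T$, of availabilities, rankings and capacities for $T$ rounds and of means $\mu_{i,j}$, such that the $T_i$ tend to infinity and are comparable ($T_i\le C\,T_j$ for all $i,j$ and all large $T$, for some constant $C$), $K_T=O(\log T_i)$ for every $i$, and all means belong to a finite set that does not depend on $T$. For $\alpha\in[0,1)$ a policy is *$\alpha$-consistent* if for every problem instance, every $c>\alpha$ and every player $p_i$, $\overline R_i(T_i)$ or $\underline R_i(T_i)$ is bounded above by $o(T_i^c)$. **Theorem.** For every $\alpha\in[0,1)$ there is a constant $\kappa>0$, depending only on $\alpha$, such that the following holds. Let $N\ge2$, let $K_T\ge N$ with $K_T=O(\log T)$, consider any $\alpha$-consistent policy, and let $0<\Delta\le\frac1{4N}$. Then there is a problem instance whose minimum gap is exactly $\Delta$ for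 every $T\ge 1$, and a player $p_i$, such that $\overline R_i(T_i)\ge\underline R_i(T_i)$ for every $T$ and, for all sufficiently large $T$, $$\underline R_i(T_i)\ \ge\ \kappa\,\frac{N(K_T-N+1)\log T_i}{\Delta^2}.$$ -/

import Mathlib

open Filter Asymptotics

namespace SleepingBandits

/-- The publicly known data of one round with `N` players and `K` arms in total: the available
players, the available arms, the arms' strict rankings of the players (`rank j i < rank j i'` means
that arm `j` prefers player `i` to player `i'`), and the capacities of the arms. -/
structure Round (N K : ℕ) where
  players : Finset (Fin N)
  arms : Finset (Fin K)
  rank : Fin K → Equiv.Perm (Fin N)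
  capacity : Fin K → ℕ

/-- An assignment of players to arms; `none` means "unmatched". -/
abbrev Matching (N K : ℕ) : Type := Fin N → Option (Fin K)

/-- The players matched to arm `j`. -/
def partners {N K : ℕ} (m : Matching N K) (j : Fin K) : Finset (Fin N) :=
  Finset.univ.filter fun i => m i = some j

/-- The mean reward of player `i` at an arm, and `0` when unmatched. -/
def value {N K : ℕ} (μ : Fin N → Fin K → ℝ) (i : Fin N) (a : Option (Fin K)) : ℝ :=
  a.elim 0 (μ i)

namespace Round

variable {N K : ℕ}

/-- Only available players are matched, only to available arms, and capacities are respected. -/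
def Feasible (ρ : Round N K) (m : Matching N K) : Prop :=
  (∀ i, i ∉ ρ.players → m i = none) ∧
  (∀ i j, m i = some j → j ∈ ρ.arms) ∧
  ∀ j ∈ ρ.arms, (partners m j).card ≤ ρ.capacity j

/-- The pair of player `i` and arm `j` blocks the matching `m`. -/
def Blocks (ρ : Round N K) (μ : Fin N → Fin K → ℝ) (m : Matching N K)
    (i : Fin N) (j : Fin K) : Prop :=
  i ∈ ρ.players ∧ j ∈ ρ.arms ∧ value μ i (m i) < μ i j ∧
  ((partners m j).card < ρ.capacity j ∨ ∃ i' ∈ partners m j, ρ.rank j i < ρ.rank j i')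

def IsStable (ρ : Round N K) (μ : Fin N → Fin K → ℝ) (m : Matching N K) : Prop :=
  ρ.Feasible m ∧ ∀ i j, ¬ ρ.Blocks μ m i j

/-- A stable matching that every available player weakly prefers to every stable matching. -/
def IsPlayerOptimal (ρ : Round N K) (μ : Fin N → Fin K → ℝ) (m : Matching N K) : Prop :=
  ρ.IsStable μ m ∧
  ∀ m', ρ.IsStable μ m' → ∀ i ∈ ρ.players, value μ i (m' i) ≤ value μ i (m i)

/-- A stable matching to which every available player weakly prefers every stable matching. -/
def IsPlayerPessimal (ρ : Round N K) (μ : Fin N → Fin K → ℝ) (m : Matching N K) : Prop :=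
  ρ.IsStable μ m ∧
  ∀ m', ρ.IsStable μ m' → ∀ i ∈ ρ.players, value μ i (m i) ≤ value μ i (m' i)

/-- The player-optimal stable matching (by Gale and Shapley it exists, and it is unique, as soon
as the means of the available arms are positive and distinct for each available player). -/
noncomputable def playerOptimal (ρ : Round N K) (μ : Fin N → Fin K → ℝ) : Matching N K :=
  Classical.epsilon (ρ.IsPlayerOptimal μ)

/-- The player-pessimal stable matching (existence and uniqueness as for `playerOptimal`). -/
noncomputable def playerPessimal (ρ : Round N K) (μ : Fin N → Fin K → ℝ) : Matching N K :=
  Classical.epsilon (ρ.IsPlayerPessimal μ)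

end Round

/-- What the platform sees of a round after choosing: its matching and the `{0,1}`-valued rewards
(`true` is reward `1`; the reward of an unmatched player is `0`). -/
abbrev Outcome (N K : ℕ) : Type := Matching N K × (Fin N → Bool)

/-- A (possibly randomized) policy of the platform. In round `t` (counted from `0`) it draws a
feasible matching from a law depending on the public data of the rounds `0, …, t` and on the
matchings and rewards of the rounds `0, …, t - 1`. -/
structure Policy (N K : ℕ) where
  act : (t : ℕ) → (Fin (t + 1) → Round N K) → (Fin t → Outcome N K) → PMF (Matching N K)
  feasible : ∀ (t : ℕ) (e : Fin (t + 1) → Round N K) (h : Fin t → Outcome N K),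
    ∀ m ∈ (act t e h).support, (e (Fin.last t)).Feasible m

/-- The public data of all rounds up to a horizon `T`. -/
abbrev Env (N K T : ℕ) : Type := Fin T → Round N K

section Horizon

variable {N K T : ℕ}

/-- The number of rounds in which player `i` is available. -/
def Env.roundsOf (E : Env N K T) (i : Fin N) : ℕ :=
  (Finset.univ.filter fun t => i ∈ (E t).players).card

/-- The probability of reward `r` for player `i` when assigned `a`: Bernoulli with mean `μ i j`
for `a = some j`, and reward `0` surely for `a = none`. -/
def rewardProb (μ : Fin N → Fin K → ℝ) (i : Fin N) (a : Option (Fin K)) (r : Bool) : ℝ :=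
  if r then value μ i a else 1 - value μ i a

/-- The probability of a trajectory `ω` of matchings and rewards when policy `π` faces the
environment `E` and the mean rewards `μ`. -/
noncomputable def trajProb (π : Policy N K) (E : Env N K T) (μ : Fin N → Fin K → ℝ)
    (ω : Fin T → Outcome N K) : ℝ :=
  ∏ t : Fin T,
    ((π.act t (fun s => E ⟨s, by omega⟩) (fun s => ω ⟨s, by omega⟩) (ω t).1).toReal *
      ∏ i, rewardProb μ i ((ω t).1 i) ((ω t).2 i))

/-- The expected reward of player `i` in round `t`. -/
noncomputable def expReward (π : Policy N K) (E : Env N K T) (μ : Fin N → Fin K → ℝ)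
    (i : Fin N) (t : Fin T) : ℝ :=
  ∑ ω : Fin T → Outcome N K, trajProb π E μ ω * (if (ω t).2 i then 1 else 0)

/-- The player-optimal stable regret of player `i`. -/
noncomputable def optRegret (π : Policy N K) (E : Env N K T) (μ : Fin N → Fin K → ℝ)
    (i : Fin N) : ℝ :=
  ∑ t with i ∈ (E t).players,
    (value μ i ((E t).playerOptimal μ i) - expReward π E μ i t)

/-- The player-pessimal stable regret of player `i`. -/
noncomputable def pessRegret (π : Policy N K) (E : Env N K T) (μ : Fin N → Fin K → ℝ)
    (i : Fin N) : ℝ :=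
  ∑ t with i ∈ (E t).players,
    (value μ i ((E t).playerPessimal μ i) - expReward π E μ i t)

/-- Standing assumptions on the means: they lie in `(0,1)`, and no player has equal means at two
arms that are available in the same round. -/
def ValidMeans (E : Env N K T) (μ : Fin N → Fin K → ℝ) : Prop :=
  (∀ i j, μ i j ∈ Set.Ioo (0 : ℝ) 1) ∧
  ∀ i t, ∀ j ∈ (E t).arms, ∀ j' ∈ (E t).arms, j ≠ j' → μ i j ≠ μ i j'

/-- The gaps between the means of two distinct arms available in one round, for an available
player. The minimum gap of the instance is the least element of this set. -/
def gaps (E : Env N K T) (μ : Fin N → Fin K → ℝ) : Set ℝ :=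
  {d | ∃ i t j j', i ∈ (E t).players ∧ j ∈ (E t).arms ∧ j' ∈ (E t).arms ∧ j ≠ j' ∧
    d = |μ i j - μ i j'|}

end Horizon

section Asymptotics

variable {N : ℕ} {K : ℕ → ℕ}

/-- Assumptions on a family of environments, one for each horizon `T`, with `N` players and `K T`
arms: the numbers of rounds of the players tend to infinity and are comparable, and the number of
arms is at most logarithmic in them. -/
def Admissible (E : ∀ T, Env N (K T) T) : Prop :=
  (∀ i, Tendsto (fun T => (E T).roundsOf i) atTop atTop) ∧
  (∃ C : ℝ, ∀ᶠ T in atTop, ∀ i j, ((E T).roundsOf i : ℝ) ≤ C * (E T).roundsOf j) ∧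
  ∀ i, (fun T => (K T : ℝ)) =O[atTop] fun T => Real.log ((E T).roundsOf i)

/-- A family of problem instances, one for each horizon `T`. The Bernoulli distributions occurring
in it form a finite set that does not depend on `T` (so for constant `K`, only finitely many
different matrices of distributions occur). -/
def IsInstance (E : ∀ T, Env N (K T) T) (μ : ∀ T, Fin N → Fin (K T) → ℝ) : Prop :=
  Admissible E ∧ (∀ T, ValidMeans (E T) (μ T)) ∧ ∃ V : Finset ℝ, ∀ T i j, μ T i j ∈ V

/-- `R` is bounded above by a function that is `o(n ^ c)`. -/
def BoundedByLittleO (R : ℕ → ℝ) (n : ℕ → ℕ) (c : ℝ) : Prop :=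
  ∀ ε > 0, ∀ᶠ T in atTop, R T ≤ ε * (n T : ℝ) ^ c

/-- `α`-consistency of a policy that may depend on the number of arms and on the horizon. -/
def IsConsistent (α : ℝ) (π : ∀ T, Policy N (K T)) : Prop :=
  ∀ (E : ∀ T, Env N (K T) T) (μ : ∀ T, Fin N → Fin (K T) → ℝ), IsInstance E μ →
    ∀ c > α, ∀ i,
      BoundedByLittleO (fun T => optRegret (π T) (E T) (μ T) i) (fun T => (E T).roundsOf i) c ∨
      BoundedByLittleO (fun T => pessRegret (π T) (E T) (μ T) i) (fun T => (E T).roundsOf i) c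

end Asymptotics

end SleepingBandits

namespace SleepingBandits

section Testing

/-- A form of the Bretagnolle–Huber inequality for a randomized test `X` between the weights `p`
and `p * exp (-L)` on a finite type. -/
theorem half_exp_neg_le_test {Ω : Type*} [Fintype Ω] (p L X : Ω → ℝ) (hp : ∀ ω, 0 ≤ p ω)
    (hp1 : ∑ ω, p ω = 1) (hq1 : ∑ ω, p ω * Real.exp (-L ω) = 1)
    (hX0 : ∀ ω, 0 ≤ X ω) (hX1 : ∀ ω, X ω ≤ 1) :
    Real.exp (-∑ ω, p ω * L ω) / 2 ≤
      ∑ ω, p ω * X ω + ∑ ω, p ω * Real.exp (-L ω) * (1 - X ω) := by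
  set D := ∑ ω, p ω * L ω with hD
  set q : Ω → ℝ := fun ω => p ω * Real.exp (-L ω) with hq
  have hq0 : ∀ ω, 0 ≤ q ω := fun ω => mul_nonneg (hp ω) (Real.exp_pos _).le
  have jensen : Real.exp (-D / 2) ≤ ∑ ω, p ω * Real.exp (-L ω / 2) := by
    have h : ∀ ω, p ω * (Real.exp (-D / 2) * (1 + D / 2) - Real.exp (-D / 2) / 2 * L ω) ≤
        p ω * Real.exp (-L ω / 2) := fun ω => by
      refine mul_le_mul_of_nonneg_left ?_ (hp ω)
      have h1 := Real.add_one_le_exp (-L ω / 2 + D / 2)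
      have h2 : Real.exp (-L ω / 2) = Real.exp (-D / 2) * Real.exp (-L ω / 2 + D / 2) := by
        rw [← Real.exp_add]; ring_nf
      rw [h2]
      nlinarith [Real.exp_pos (-D / 2)]
    refine le_trans (le_of_eq ?_) (Finset.sum_le_sum fun ω _ => h ω)
    have : ∀ ω, p ω * (Real.exp (-D / 2) * (1 + D / 2) - Real.exp (-D / 2) / 2 * L ω) =
        Real.exp (-D / 2) * (1 + D / 2) * p ω - Real.exp (-D / 2) / 2 * (p ω * L ω) :=
      fun ω => by ring
    simp only [this, Finset.sum_sub_distrib, ← Finset.mul_sum, hp1, ← hD]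
    ring
  have hmin : ∀ ω, 0 ≤ min (p ω) (q ω) := fun ω => le_min (hp ω) (hq0 ω)
  have hmax : ∀ ω, 0 ≤ max (p ω) (q ω) := fun ω => le_max_of_le_left (hp ω)
  have cs := Finset.sum_mul_sq_le_sq_mul_sq Finset.univ
    (fun ω => Real.sqrt (min (p ω) (q ω))) (fun ω => Real.sqrt (max (p ω) (q ω)))
  simp only [Real.sq_sqrt (hmin _), Real.sq_sqrt (hmax _)] at cs
  have hprod : ∀ ω, Real.sqrt (min (p ω) (q ω)) * Real.sqrt (max (p ω) (q ω)) =
      p ω * Real.exp (-L ω / 2) := fun ω => by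
    rw [← Real.sqrt_mul (hmin ω), min_mul_max]
    have : p ω * q ω = (p ω * Real.exp (-L ω / 2)) ^ 2 := by
      rw [mul_pow, ← Real.exp_nat_mul, hq]
      push_cast
      rw [show 2 * (-L ω / 2) = -L ω by ring]
      ring
    rw [this, Real.sqrt_sq (mul_nonneg (hp ω) (Real.exp_pos _).le)]
  simp only [hprod] at cs
  have hmaxsum : ∑ ω, max (p ω) (q ω) ≤ 2 := by
    calc ∑ ω, max (p ω) (q ω) ≤ ∑ ω, (p ω + q ω) :=
          Finset.sum_le_sum fun ω _ => max_le_add_of_nonneg (hp ω) (hq0 ω)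
      _ = 2 := by rw [Finset.sum_add_distrib, hp1, hq1]; norm_num
  have hminsum : ∑ ω, min (p ω) (q ω) ≤ ∑ ω, p ω * X ω + ∑ ω, q ω * (1 - X ω) := by
    rw [← Finset.sum_add_distrib]
    refine Finset.sum_le_sum fun ω _ => ?_
    have h1 := mul_le_mul_of_nonneg_right (min_le_left (p ω) (q ω)) (hX0 ω)
    have h2 := mul_le_mul_of_nonneg_right (min_le_right (p ω) (q ω)) (sub_nonneg.2 (hX1 ω))
    linarith
  have hsq : Real.exp (-D) = Real.exp (-D / 2) ^ 2 := by
    rw [← Real.exp_nat_mul]; push_cast; ring_nf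
  have hmin0 : 0 ≤ ∑ ω, min (p ω) (q ω) := Finset.sum_nonneg fun ω _ => hmin ω
  have := pow_le_pow_left₀ (Real.exp_pos _).le jensen 2
  nlinarith

/-- The Kullback–Leibler divergence of Bernoulli laws is at most their `χ²`-divergence. -/
theorem bernoulli_kl_le {p q : ℝ} (hp0 : 0 < p) (hp1 : p < 1) (hq0 : 0 < q) (hq1 : q < 1) :
    p * Real.log (p / q) + (1 - p) * Real.log ((1 - p) / (1 - q)) ≤
      (p - q) ^ 2 / (q * (1 - q)) := by
  have h1 := Real.log_le_sub_one_of_pos (div_pos hp0 hq0)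
  have h2 := Real.log_le_sub_one_of_pos (div_pos (sub_pos.2 hp1) (sub_pos.2 hq1))
  have hq' : 0 < 1 - q := sub_pos.2 hq1
  have h : (p - q) ^ 2 / (q * (1 - q)) =
      p * (p / q - 1) + (1 - p) * ((1 - p) / (1 - q) - 1) := by
    field_simp
    ring
  rw [h]
  exact add_le_add (mul_le_mul_of_nonneg_left h1 hp0.le)
    (mul_le_mul_of_nonneg_left h2 (sub_nonneg.2 hp1.le))

end Testing

section Trajectories

variable {N K : ℕ}

theorem value_nonneg {μ : Fin N → Fin K → ℝ} (h : ∀ i j, 0 ≤ μ i j) (i : Fin N)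
    (a : Option (Fin K)) : 0 ≤ value μ i a := by
  cases a <;> simp [value, h]

theorem value_le_one {μ : Fin N → Fin K → ℝ} (h : ∀ i j, μ i j ≤ 1) (i : Fin N)
    (a : Option (Fin K)) : value μ i a ≤ 1 := by
  cases a <;> simp [value, h]

theorem rewardProb_nonneg {μ : Fin N → Fin K → ℝ} (h0 : ∀ i j, 0 ≤ μ i j) (h1 : ∀ i j, μ i j ≤ 1)
    (i : Fin N) (a : Option (Fin K)) (r : Bool) : 0 ≤ rewardProb μ i a r := by
  cases r <;> simp [rewardProb, value_nonneg h0, value_le_one h1]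

theorem sum_rewardProb (μ : Fin N → Fin K → ℝ) (i : Fin N) (a : Option (Fin K)) :
    ∑ r, rewardProb μ i a r = 1 := by
  simp [rewardProb]

theorem sum_prod_rewardProb (μ : Fin N → Fin K → ℝ) (m : Matching N K) :
    ∑ r : Fin N → Bool, ∏ i, rewardProb μ i (m i) (r i) = 1 := by
  have h := Finset.prod_univ_sum (fun _ : Fin N => (Finset.univ : Finset Bool))
    (fun i r => rewardProb μ i (m i) r)
  rw [Fintype.piFinset_univ] at h
  rw [← h]
  exact Finset.prod_eq_one fun i _ => sum_rewardProb μ i (m i)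

theorem sum_prod_rewardProb_mul (μ : Fin N → Fin K → ℝ) (m : Matching N K) (i₀ : Fin N)
    (g : Bool → ℝ) :
    ∑ r : Fin N → Bool, (∏ i, rewardProb μ i (m i) (r i)) * g (r i₀) =
      ∑ b, rewardProb μ i₀ (m i₀) b * g b := by
  have h := Finset.prod_univ_sum (fun _ : Fin N => (Finset.univ : Finset Bool))
    (fun i r => rewardProb μ i (m i) r * if i = i₀ then g r else 1)
  rw [Fintype.piFinset_univ] at h
  have h' : ∀ r : Fin N → Bool, (∏ i, rewardProb μ i (m i) (r i)) * g (r i₀) =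
      ∏ i, (rewardProb μ i (m i) (r i) * if i = i₀ then g (r i) else 1) := fun r => by
    rw [Finset.prod_mul_distrib, Finset.prod_ite_eq' Finset.univ i₀ (fun i => g (r i))]
    simp
  simp only [h', ← h]
  rw [Finset.prod_eq_single i₀]
  · simp
  · intro i _ hi
    simp only [hi, if_false, mul_one]
    exact sum_rewardProb μ i (m i)
  · simp

theorem sum_toReal_pmf {β : Type*} [Fintype β] (p : PMF β) : ∑ b, (p b).toReal = 1 := by
  rw [← ENNReal.toReal_sum fun b _ => p.apply_ne_top b, ← tsum_fintype (L := .unconditional β),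
    p.tsum_coe, ENNReal.toReal_one]

/-- The law of the last outcome given the earlier ones. -/
noncomputable def lastProb {T : ℕ} (π : Policy N K) (E : Env N K (T + 1)) (μ : Fin N → Fin K → ℝ)
    (h : Fin T → Outcome N K) (o : Outcome N K) : ℝ :=
  (π.act T E h o.1).toReal * ∏ i, rewardProb μ i (o.1 i) (o.2 i)

theorem trajProb_snoc {T : ℕ} (π : Policy N K) (E : Env N K (T + 1)) (μ : Fin N → Fin K → ℝ)
    (h : Fin T → Outcome N K) (o : Outcome N K) :
    trajProb π E μ (Fin.snoc (α := fun _ => Outcome N K) h o) =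
      trajProb π (fun t => E t.castSucc) μ h * lastProb π E μ h o := by
  unfold trajProb lastProb
  rw [Fin.prod_univ_castSucc]
  congr 1
  · refine Finset.prod_congr rfl fun t _ => ?_
    simp only [Fin.snoc_castSucc]
    congr 4
    funext s
    exact Fin.snoc_castSucc (α := fun _ => Outcome N K) o h ⟨s, by omega⟩
  · simp only [Fin.snoc_last]
    congr 4
    funext s
    exact Fin.snoc_castSucc (α := fun _ => Outcome N K) o h ⟨s, by omega⟩

theorem sum_snoc {T : ℕ} {β : Type*} [Fintype β] (F : (Fin (T + 1) → β) → ℝ) :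
    ∑ ω, F ω = ∑ h : Fin T → β, ∑ o, F (Fin.snoc (α := fun _ => β) h o) := by
  rw [← (Fin.snocEquiv fun _ : Fin (T + 1) => β).sum_comp, Fintype.sum_prod_type_right]
  rfl

theorem sum_lastProb_mul {T : ℕ} (π : Policy N K) (E : Env N K (T + 1)) (μ : Fin N → Fin K → ℝ)
    (h : Fin T → Outcome N K) (i : Fin N) (f : Option (Fin K) → Bool → ℝ) :
    ∑ o, lastProb π E μ h o * f (o.1 i) (o.2 i) =
      ∑ o, lastProb π E μ h o * ∑ b, rewardProb μ i (o.1 i) b * f (o.1 i) b := by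
  unfold lastProb
  rw [Fintype.sum_prod_type, Fintype.sum_prod_type]
  refine Finset.sum_congr rfl fun m _ => ?_
  simp only [mul_assoc, ← Finset.mul_sum]
  rw [sum_prod_rewardProb_mul μ m i (f (m i)), ← Finset.sum_mul, sum_prod_rewardProb, one_mul]

theorem sum_lastProb {T : ℕ} (π : Policy N K) (E : Env N K (T + 1)) (μ : Fin N → Fin K → ℝ)
    (h : Fin T → Outcome N K) : ∑ o, lastProb π E μ h o = 1 := by
  unfold lastProb
  rw [Fintype.sum_prod_type]
  simp only [← Finset.mul_sum, sum_prod_rewardProb, mul_one]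
  exact sum_toReal_pmf _

theorem sum_trajProb {T : ℕ} (π : Policy N K) (E : Env N K T) (μ : Fin N → Fin K → ℝ) :
    ∑ ω, trajProb π E μ ω = 1 := by
  induction T with
  | zero => simp [trajProb]
  | succ T ih =>
    rw [sum_snoc]
    simp only [trajProb_snoc, ← Finset.mul_sum, sum_lastProb, mul_one]
    exact ih _

/-- Given its matching, the reward of player `i` in round `t` has its Bernoulli law. -/
theorem sum_trajProb_mul_reward {T : ℕ} (π : Policy N K) (E : Env N K T) (μ : Fin N → Fin K → ℝ)
    (t : Fin T) (i : Fin N) (f : Option (Fin K) → Bool → ℝ) :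
    ∑ ω, trajProb π E μ ω * f ((ω t).1 i) ((ω t).2 i) =
      ∑ ω, trajProb π E μ ω * ∑ b, rewardProb μ i ((ω t).1 i) b * f ((ω t).1 i) b := by
  induction T with
  | zero => exact t.elim0
  | succ T ih =>
    rw [sum_snoc, sum_snoc (fun ω => trajProb π E μ ω *
      ∑ b, rewardProb μ i ((ω t).1 i) b * f ((ω t).1 i) b)]
    simp only [trajProb_snoc]
    induction t using Fin.lastCases with
    | last =>
      simp only [Fin.snoc_last, mul_assoc, ← Finset.mul_sum, sum_lastProb_mul π E μ _ i f]
    | cast t =>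
      simp only [Fin.snoc_castSucc, mul_right_comm _ (lastProb _ _ _ _ _), ← Finset.mul_sum,
        sum_lastProb, mul_one]
      exact ih _ t

theorem trajProb_nonneg {T : ℕ} (π : Policy N K) (E : Env N K T) {μ : Fin N → Fin K → ℝ}
    (h0 : ∀ i j, 0 ≤ μ i j) (h1 : ∀ i j, μ i j ≤ 1) (ω : Fin T → Outcome N K) :
    0 ≤ trajProb π E μ ω :=
  Finset.prod_nonneg fun _ _ => mul_nonneg ENNReal.toReal_nonneg
    (Finset.prod_nonneg fun _ _ => rewardProb_nonneg h0 h1 _ _ _)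

theorem feasible_of_trajProb_ne_zero {T : ℕ} {π : Policy N K} {E : Env N K T}
    {μ : Fin N → Fin K → ℝ} {ω : Fin T → Outcome N K} (h : trajProb π E μ ω ≠ 0) (t : Fin T) :
    (E t).Feasible (ω t).1 := by
  have h1 := Finset.prod_ne_zero_iff.1 h t (Finset.mem_univ t)
  refine π.feasible t (fun s => E ⟨s, by omega⟩) (fun s => ω ⟨s, by omega⟩) (ω t).1 ?_
  rw [PMF.mem_support_iff]
  intro h2
  simp [h2] at h1

theorem expReward_eq {T : ℕ} (π : Policy N K) (E : Env N K T) (μ : Fin N → Fin K → ℝ)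
    (i : Fin N) (t : Fin T) :
    expReward π E μ i t = ∑ ω, trajProb π E μ ω * value μ i ((ω t).1 i) := by
  unfold expReward
  rw [sum_trajProb_mul_reward π E μ t i fun _ b => if b then 1 else 0]
  simp [rewardProb]

/-- The probability that player `i` is assigned to arm `j` in round `t`. -/
noncomputable def pullProb {T : ℕ} (π : Policy N K) (E : Env N K T) (μ : Fin N → Fin K → ℝ)
    (i : Fin N) (j : Fin K) (t : Fin T) : ℝ :=
  ∑ ω, trajProb π E μ ω * if (ω t).1 i = some j then 1 else 0

theorem pullProb_nonneg {T : ℕ} (π : Policy N K) (E : Env N K T) {μ : Fin N → Fin K → ℝ}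
    (h0 : ∀ i j, 0 ≤ μ i j) (h1 : ∀ i j, μ i j ≤ 1) (i : Fin N) (j : Fin K) (t : Fin T) :
    0 ≤ pullProb π E μ i j t :=
  Finset.sum_nonneg fun ω _ => mul_nonneg (trajProb_nonneg π E h0 h1 ω) (by split_ifs <;> simp)

/-- The log-likelihood ratio of a reward when only the mean of arm `j` is in doubt. -/
noncomputable def logRatio (p q : ℝ) (j : Fin K) (a : Option (Fin K)) (b : Bool) : ℝ :=
  if a = some j then
    if b then Real.log (p / q) else Real.log ((1 - p) / (1 - q))
  else 0

theorem trajProb_eq_mul_exp {T : ℕ} (π : Policy N K) (E : Env N K T) {μ μ' : Fin N → Fin K → ℝ}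
    (i : Fin N) (j : Fin K) (hμ : μ i j ∈ Set.Ioo (0 : ℝ) 1) (hμ' : μ' i j ∈ Set.Ioo (0 : ℝ) 1)
    (heq : ∀ i' j', (i', j') ≠ (i, j) → μ' i' j' = μ i' j') (ω : Fin T → Outcome N K) :
    trajProb π E μ' ω = trajProb π E μ ω *
      Real.exp (-∑ t, logRatio (μ i j) (μ' i j) j ((ω t).1 i) ((ω t).2 i)) := by
  rw [← Finset.sum_neg_distrib, Real.exp_sum]
  unfold trajProb
  rw [← Finset.prod_mul_distrib]
  refine Finset.prod_congr rfl fun t _ => ?_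
  rw [mul_assoc]
  congr 1
  rw [← Finset.mul_prod_erase _ _ (Finset.mem_univ i),
    ← Finset.mul_prod_erase _ (fun i => rewardProb μ i ((ω t).1 i) ((ω t).2 i))
      (Finset.mem_univ i), mul_right_comm]
  congr 1
  · have hp := hμ.1
    have hp1 : 0 < 1 - μ i j := sub_pos.2 hμ.2
    have hq := hμ'.1
    have hq1 : 0 < 1 - μ' i j := sub_pos.2 hμ'.2
    rcases ha : (ω t).1 i with _ | j'
    · simp [rewardProb, value, logRatio]
    · by_cases hj : j' = j
      · subst hj
        cases (ω t).2 i
        · simp only [rewardProb, value, logRatio, Option.elim_some, if_true, Bool.false_eq_true,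
            if_false]
          rw [Real.exp_neg, Real.exp_log (div_pos hp1 hq1)]
          field_simp
        · simp only [rewardProb, value, logRatio, Option.elim_some, if_true]
          rw [Real.exp_neg, Real.exp_log (div_pos hp hq)]
          field_simp
      · simp [rewardProb, value, logRatio, hj, heq i j' (by simpa using hj)]
  · refine Finset.prod_congr rfl fun i' hi' => ?_
    have hne : i' ≠ i := (Finset.mem_erase.1 hi').1
    rcases (ω t).1 i' with _ | j'
    · simp [rewardProb, value]
    · simp [rewardProb, value, heq i' j' (by simp [hne])]

/-- The change-of-measure bound: a policy cannot assign player `i` to arm `j` rarely under `μ` and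
often under `μ'` in the rounds of `S`, unless the two means are distinguishable from the expected
number of assignments under `μ`. -/
theorem change_of_measure {T : ℕ} (π : Policy N K) (E : Env N K T) {μ μ' : Fin N → Fin K → ℝ}
    (i : Fin N) (j : Fin K) (hμ : ∀ i j, μ i j ∈ Set.Ioo (0 : ℝ) 1)
    (hμ' : μ' i j ∈ Set.Ioo (0 : ℝ) 1)
    (heq : ∀ i' j', (i', j') ≠ (i, j) → μ' i' j' = μ i' j') (S : Finset (Fin T)) :
    Real.exp (-((μ i j - μ' i j) ^ 2 / (μ' i j * (1 - μ' i j)) * ∑ t, pullProb π E μ i j t)) / 2 *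
        S.card ≤
      ∑ t, pullProb π E μ i j t + ∑ t ∈ S, (1 - pullProb π E μ' i j t) := by
  have h0 : ∀ i j, 0 ≤ μ i j := fun i j => (hμ i j).1.le
  have h1 : ∀ i j, μ i j ≤ 1 := fun i j => (hμ i j).2.le
  have hpull : ∀ t, 0 ≤ pullProb π E μ i j t := pullProb_nonneg π E h0 h1 i j
  set x : (Fin T → Outcome N K) → Fin T → ℝ := fun ω t => if (ω t).1 i = some j then 1 else 0
    with hx
  have hx0 : ∀ ω t, 0 ≤ x ω t := fun ω t => by simp only [hx]; split_ifs <;> simp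
  have hx1 : ∀ ω t, x ω t ≤ 1 := fun ω t => by simp only [hx]; split_ifs <;> simp
  set L : (Fin T → Outcome N K) → ℝ :=
    fun ω => ∑ t, logRatio (μ i j) (μ' i j) j ((ω t).1 i) ((ω t).2 i) with hL
  have hq : ∀ ω, trajProb π E μ' ω = trajProb π E μ ω * Real.exp (-L ω) :=
    trajProb_eq_mul_exp π E i j (hμ i j) hμ' heq
  rcases S.eq_empty_or_nonempty with rfl | hS
  · simpa using Finset.sum_nonneg fun t _ => hpull t
  have hS0 : (0 : ℝ) < S.card := by exact_mod_cast hS.card_pos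
  have test := half_exp_neg_le_test (trajProb π E μ) L (fun ω => (∑ t ∈ S, x ω t) / S.card)
    (trajProb_nonneg π E h0 h1) (sum_trajProb π E μ)
    (by simp only [← hq]; exact sum_trajProb π E μ')
    (fun ω => div_nonneg (Finset.sum_nonneg fun t _ => hx0 ω t) hS0.le)
    (fun ω => by
      rw [div_le_one hS0]
      simpa using Finset.sum_le_sum fun t (_ : t ∈ S) => hx1 ω t)
  simp only [← hq] at test
  have hKL : ∑ ω, trajProb π E μ ω * L ω ≤
      (μ i j - μ' i j) ^ 2 / (μ' i j * (1 - μ' i j)) * ∑ t, pullProb π E μ i j t := by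
    simp only [hL, Finset.mul_sum]
    rw [Finset.sum_comm]
    refine Finset.sum_le_sum fun t _ => ?_
    rw [sum_trajProb_mul_reward π E μ t i fun a b => logRatio (μ i j) (μ' i j) j a b, pullProb,
      Finset.mul_sum]
    refine Finset.sum_le_sum fun ω _ => ?_
    rw [mul_left_comm]
    refine mul_le_mul_of_nonneg_left ?_ (trajProb_nonneg π E h0 h1 ω)
    by_cases ha : (ω t).1 i = some j
    · simpa [ha, logRatio, rewardProb, value] using
        bernoulli_kl_le (hμ i j).1 (hμ i j).2 hμ'.1 hμ'.2
    · simp [ha, logRatio]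
  have hfirst : ∑ ω, trajProb π E μ ω * ((∑ t ∈ S, x ω t) / S.card) * S.card ≤
      ∑ t, pullProb π E μ i j t := by
    calc ∑ ω, trajProb π E μ ω * ((∑ t ∈ S, x ω t) / S.card) * S.card
        = ∑ t ∈ S, pullProb π E μ i j t := by
          simp only [pullProb]
          rw [Finset.sum_comm]
          refine Finset.sum_congr rfl fun ω _ => ?_
          rw [mul_assoc, div_mul_cancel₀ _ hS0.ne', Finset.mul_sum]
      _ ≤ _ := Finset.sum_le_sum_of_subset_of_nonneg (Finset.subset_univ S) fun t _ _ => hpull t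
  have hsecond : ∑ ω, trajProb π E μ' ω * (1 - (∑ t ∈ S, x ω t) / S.card) * S.card =
      ∑ t ∈ S, (1 - pullProb π E μ' i j t) := by
    have : ∀ t ∈ S, 1 - pullProb π E μ' i j t = ∑ ω, trajProb π E μ' ω * (1 - x ω t) :=
      fun t _ => by
        simp only [mul_sub, mul_one, Finset.sum_sub_distrib, sum_trajProb, pullProb, hx]
    rw [Finset.sum_congr rfl this, Finset.sum_comm]
    refine Finset.sum_congr rfl fun ω _ => ?_
    rw [← Finset.mul_sum, Finset.sum_sub_distrib, mul_assoc, sub_mul, div_mul_cancel₀ _ hS0.ne']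
    simp
  have hexp := Real.exp_le_exp.2 (neg_le_neg hKL)
  have := mul_le_mul_of_nonneg_right test hS0.le
  rw [add_mul, Finset.sum_mul, Finset.sum_mul, hsecond] at this
  nlinarith

end Trajectories

section StableMatchings

variable {N K : ℕ}

theorem Round.playerOptimal_eq {ρ : Round N K} {μ : Fin N → Fin K → ℝ} {m : Matching N K}
    (h : ∀ m', ρ.IsStable μ m' ↔ m' = m) : ρ.playerOptimal μ = m := by
  have hm : ρ.IsPlayerOptimal μ m :=
    ⟨(h m).2 rfl, fun m' h' i _ => by rw [(h m').1 h']⟩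
  exact (h _).1 (Classical.epsilon_spec (p := ρ.IsPlayerOptimal μ) ⟨m, hm⟩).1

theorem Round.playerPessimal_eq {ρ : Round N K} {μ : Fin N → Fin K → ℝ} {m : Matching N K}
    (h : ∀ m', ρ.IsStable μ m' ↔ m' = m) : ρ.playerPessimal μ = m := by
  have hm : ρ.IsPlayerPessimal μ m :=
    ⟨(h m).2 rfl, fun m' h' i _ => by rw [(h m').1 h']⟩
  exact (h _).1 (Classical.epsilon_spec (p := ρ.IsPlayerPessimal μ) ⟨m, hm⟩).1

/-- The round in which the players `a`, `b` meet the arms `x`, `y`, each of capacity one and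
preferring the player with the smaller index. -/
def duel (a b : Fin N) (x y : Fin K) : Round N K where
  players := {a, b}
  arms := {x, y}
  rank _ := Equiv.refl _
  capacity _ := 1

/-- The matching of `a` with `x` and of `b` with `y`. -/
def duelMatching (a b : Fin N) (x y : Fin K) : Matching N K :=
  fun i => if i = a then some x else if i = b then some y else none

theorem duel_swap (a b : Fin N) (x y : Fin K) : duel a b x y = duel a b y x := by
  simp [duel, Finset.pair_comm]

theorem duel_feasible_cases {a b : Fin N} {x y : Fin K} {m : Matching N K}
    (h : (duel a b x y).Feasible m) (i : Fin N) :
    m i = none ∨ m i = some x ∨ m i = some y := by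
  rcases hm : m i with _ | j
  · exact Or.inl rfl
  · have := h.2.1 i j hm
    simp only [duel, Finset.mem_insert, Finset.mem_singleton] at this
    rcases this with rfl | rfl <;> simp

theorem duel_feasible_eq {a b : Fin N} {x y : Fin K} {m : Matching N K}
    (h : (duel a b x y).Feasible m) {i i' : Fin N} {j : Fin K} (hi : m i = some j)
    (hi' : m i' = some j) : i = i' :=
  Finset.card_le_one.1 (h.2.2 j (h.2.1 i j hi)) i (by simp [partners, hi]) i'
    (by simp [partners, hi'])

/-- If the preferred player `a` likes `x` best, then the only stable matching of a duel pairs `a`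
with `x` and leaves `y` to the other player. -/
theorem duel_isStable_iff {a b : Fin N} {x y : Fin K} {μ : Fin N → Fin K → ℝ} (hab : a < b)
    (hxy : x ≠ y) (ha : μ a y < μ a x) (ha0 : 0 < μ a x) (hb0 : 0 < μ b y) (m : Matching N K) :
    (duel a b x y).IsStable μ m ↔ m = duelMatching a b x y := by
  constructor
  · rintro ⟨hf, hs⟩
    have hnone : ∀ i, i ≠ a → i ≠ b → m i = none := fun i h1 h2 => hf.1 i (by simp [duel, h1, h2])
    have hma : m a = some x := by
      by_contra hne
      refine hs a x ⟨by simp [duel], by simp [duel], ?_, ?_⟩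
      · rcases duel_feasible_cases hf a with h | h | h
        · simpa [h, value] using ha0
        · exact absurd h hne
        · simpa [h, value] using ha
      · by_cases hmb : m b = some x
        · exact Or.inr ⟨b, by simp [partners, hmb], by simpa [duel] using hab⟩
        · left
          have : partners m x = ∅ := by
            simp only [partners, Finset.filter_eq_empty_iff]
            intro i _ hi
            by_cases h1 : i = a
            · exact hne (h1 ▸ hi)
            by_cases h2 : i = b
            · exact hmb (h2 ▸ hi)
            simp [hnone i h1 h2] at hi
          simp [this, duel]
    have hmb : m b = some y := by
      rcases duel_feasible_cases hf b with h | h | h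
      · exfalso
        refine hs b y ⟨by simp [duel], by simp [duel], by simpa [h, value] using hb0, Or.inl ?_⟩
        have : partners m y = ∅ := by
          simp only [partners, Finset.filter_eq_empty_iff]
          intro i _ hi
          by_cases h1 : i = a
          · rw [h1, hma] at hi
            exact hxy (Option.some.inj hi)
          by_cases h2 : i = b
          · simp [h2, h] at hi
          simp [hnone i h1 h2] at hi
        simp [this, duel]
      · exact absurd (duel_feasible_eq hf hma h) hab.ne
      · exact h
    funext i
    unfold duelMatching
    split_ifs with h1 h2
    · rw [h1, hma]
    · rw [h2, hmb]
    · exact hnone i h1 h2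
  · rintro rfl
    have hpx : partners (duelMatching a b x y) x = {a} := by
      ext i
      rw [partners, Finset.mem_filter, Finset.mem_singleton, duelMatching]
      split_ifs with h1 h2 <;> simp [h1, hxy.symm]
    have hpy : partners (duelMatching a b x y) y = {b} := by
      ext i
      rw [partners, Finset.mem_filter, Finset.mem_singleton, duelMatching]
      split_ifs with h1 h2
      · simp [h1, hxy, hab.ne]
      · simp [h2]
      · simp [h2]
    refine ⟨⟨?_, ?_, ?_⟩, ?_⟩
    · intro i hi
      simp only [duel, Finset.mem_insert, Finset.mem_singleton, not_or] at hi
      simp [duelMatching, hi.1, hi.2]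
    · intro i j hj
      simp only [duelMatching] at hj
      simp only [duel, Finset.mem_insert, Finset.mem_singleton]
      split_ifs at hj
      · exact Or.inl (Option.some.inj hj).symm
      · exact Or.inr (Option.some.inj hj).symm
    · intro j hj
      simp only [duel, Finset.mem_insert, Finset.mem_singleton] at hj
      rcases hj with rfl | rfl
      · simp [hpx, duel]
      · simp [hpy, duel]
    · rintro i j ⟨hi, hj, hv, hc⟩
      simp only [duel, Finset.mem_insert, Finset.mem_singleton] at hi hj
      rcases hi with rfl | rfl
      · have : duelMatching i b x y i = some x := by simp [duelMatching]
        rw [this] at hv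
        rcases hj with rfl | rfl
        · exact lt_irrefl _ hv
        · exact lt_asymm ha hv
      · have : duelMatching a i x y i = some y := by simp [duelMatching, hab.ne']
        rw [this] at hv
        rcases hj with rfl | rfl
        · rw [hpx] at hc
          simp [duel, hab.not_gt] at hc
        · exact lt_irrefl _ hv

end StableMatchings

section HardInstance

variable {n k T : ℕ}

/-- The index of the exploring player of round `t`. -/
def explorer (n t : ℕ) : Fin (n + 1) := Fin.ofNat (n + 1) t

/-- The index of the risky arm of round `t`. -/
def riskyArm (n k t : ℕ) : Fin (k + 1) := Fin.ofNat (k + 1) (t / (n + 1))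

/-- In round `t` an exploring player and the last player meet the safe arm `0` and a risky arm;
all pairs of an exploring player and a risky arm take their turns. -/
def roundRobin (n k T : ℕ) : Env (n + 2) (k + 2) T :=
  fun t => duel (explorer n t).castSucc (Fin.last (n + 1)) 0 (riskyArm n k t).succ

/-- The exploring players value the safe arm at `1 / 2`, and the risky arms at `1 / 2 - Δ`, except
for the pairs in `A`, which have mean `1 / 2 + Δ`. The last player prefers the risky arms. -/
noncomputable def duelMeans (Δ : ℝ) (A : Finset (Fin (n + 1) × Fin (k + 1))) :
    Fin (n + 2) → Fin (k + 2) → ℝ :=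
  Fin.lastCases (motive := fun _ => Fin (k + 2) → ℝ)
    (Fin.cases (1 / 4) fun _ => 3 / 4)
    fun i => Fin.cases (1 / 2) fun j => if (i, j) ∈ A then 1 / 2 + Δ else 1 / 2 - Δ

variable {Δ : ℝ} {A : Finset (Fin (n + 1) × Fin (k + 1))}

@[simp] theorem duelMeans_last_zero :
    duelMeans Δ A (Fin.last (n + 1)) 0 = 1 / 4 := by
  simp [duelMeans]

@[simp] theorem duelMeans_last_succ (j : Fin (k + 1)) :
    duelMeans Δ A (Fin.last (n + 1)) j.succ = 3 / 4 := by
  simp [duelMeans]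

@[simp] theorem duelMeans_castSucc_zero (i : Fin (n + 1)) :
    duelMeans Δ A i.castSucc 0 = 1 / 2 := by
  simp [duelMeans]

@[simp] theorem duelMeans_castSucc_succ (i : Fin (n + 1)) (j : Fin (k + 1)) :
    duelMeans Δ A i.castSucc j.succ = if (i, j) ∈ A then 1 / 2 + Δ else 1 / 2 - Δ := by
  simp [duelMeans]

theorem duelMeans_cases (i : Fin (n + 2)) (j : Fin (k + 2)) :
    duelMeans Δ A i j ∈ ({1 / 4, 1 / 2, 3 / 4, 1 / 2 - Δ, 1 / 2 + Δ} : Finset ℝ) := by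
  induction i using Fin.lastCases with
  | last => induction j using Fin.cases <;> simp
  | cast i =>
    induction j using Fin.cases with
    | zero => simp
    | succ j =>
      rw [duelMeans_castSucc_succ]
      split_ifs <;> simp

theorem duelMeans_mem_Ioo (hΔ : 0 < Δ) (hΔ' : Δ ≤ 1 / 8) (i : Fin (n + 2)) (j : Fin (k + 2)) :
    duelMeans Δ A i j ∈ Set.Ioo (0 : ℝ) 1 := by
  have := duelMeans_cases (Δ := Δ) (A := A) i j
  simp only [Finset.mem_insert, Finset.mem_singleton] at this
  rcases this with h | h | h | h | h <;> rw [h] <;> constructor <;> linarith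

theorem abs_duelMeans_sub_castSucc (hΔ : 0 < Δ) (i : Fin (n + 1)) (j : Fin (k + 1)) :
    |duelMeans Δ A i.castSucc 0 - duelMeans Δ A i.castSucc j.succ| = Δ := by
  rw [duelMeans_castSucc_zero, duelMeans_castSucc_succ]
  split_ifs
  · rw [show (1 : ℝ) / 2 - (1 / 2 + Δ) = -Δ by ring, abs_neg, abs_of_pos hΔ]
  · rw [show (1 : ℝ) / 2 - (1 / 2 - Δ) = Δ by ring, abs_of_pos hΔ]

theorem abs_duelMeans_sub_ge (hΔ : 0 < Δ) (hΔ' : Δ ≤ 1 / 8) (i : Fin (n + 2)) (j : Fin (k + 1)) :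
    Δ ≤ |duelMeans Δ A i 0 - duelMeans Δ A i j.succ| := by
  induction i using Fin.lastCases with
  | last =>
    rw [duelMeans_last_zero, duelMeans_last_succ, show (1 : ℝ) / 4 - 3 / 4 = -(1 / 2) by norm_num,
      abs_neg, abs_of_pos (by norm_num)]
    linarith
  | cast i => exact (abs_duelMeans_sub_castSucc hΔ i j).ge

theorem abs_duelMeans_sub_ge_of_mem (hΔ : 0 < Δ) (hΔ' : Δ ≤ 1 / 8) (i : Fin (n + 2)) (t : Fin T)
    {j j' : Fin (k + 2)} (hj : j ∈ (roundRobin n k T t).arms)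
    (hj' : j' ∈ (roundRobin n k T t).arms) (hne : j ≠ j') :
    Δ ≤ |duelMeans Δ A i j - duelMeans Δ A i j'| := by
  simp only [roundRobin, duel, Finset.mem_insert, Finset.mem_singleton] at hj hj'
  rcases hj with rfl | rfl <;> rcases hj' with rfl | rfl
  · exact absurd rfl hne
  · exact abs_duelMeans_sub_ge hΔ hΔ' i _
  · rw [abs_sub_comm]
    exact abs_duelMeans_sub_ge hΔ hΔ' i _
  · exact absurd rfl hne

theorem validMeans_duelMeans (hΔ : 0 < Δ) (hΔ' : Δ ≤ 1 / 8) :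
    ValidMeans (roundRobin n k T) (duelMeans Δ A) := by
  refine ⟨duelMeans_mem_Ioo hΔ hΔ', fun i t j hj j' hj' hne heq => ?_⟩
  have := abs_duelMeans_sub_ge_of_mem (A := A) hΔ hΔ' i t hj hj' hne
  rw [heq, sub_self, abs_zero] at this
  linarith

theorem isLeast_gaps (hΔ : 0 < Δ) (hΔ' : Δ ≤ 1 / 8) (hT : 1 ≤ T) :
    IsLeast (gaps (roundRobin n k T) (duelMeans Δ A)) Δ := by
  constructor
  · refine ⟨(explorer n 0).castSucc, ⟨0, hT⟩, 0, (riskyArm n k 0).succ, ?_, ?_, ?_,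
      (Fin.succ_ne_zero _).symm, (abs_duelMeans_sub_castSucc hΔ _ _).symm⟩ <;>
    simp [roundRobin, duel]
  · rintro d ⟨i, t, j, j', -, hj, hj', hne, rfl⟩
    exact abs_duelMeans_sub_ge_of_mem hΔ hΔ' i t hj hj' hne

/-- The stable matching of a round of the round robin. -/
def stableMatching (A : Finset (Fin (n + 1) × Fin (k + 1))) (t : ℕ) :
    Matching (n + 2) (k + 2) :=
  if (explorer n t, riskyArm n k t) ∈ A then
    duelMatching (explorer n t).castSucc (Fin.last (n + 1)) (riskyArm n k t).succ 0
  else duelMatching (explorer n t).castSucc (Fin.last (n + 1)) 0 (riskyArm n k t).succ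

theorem roundRobin_isStable_iff (hΔ : 0 < Δ) (t : Fin T) (m : Matching (n + 2) (k + 2)) :
    (roundRobin n k T t).IsStable (duelMeans Δ A) m ↔ m = stableMatching A t := by
  unfold stableMatching roundRobin
  split_ifs with h
  · rw [duel_swap]
    refine duel_isStable_iff (Fin.castSucc_lt_last _) (Fin.succ_ne_zero _) ?_ ?_ ?_ m
    · simp [h, hΔ]
    · simp only [duelMeans_castSucc_succ, h, if_true]
      linarith
    · simp
  · refine duel_isStable_iff (Fin.castSucc_lt_last _) (Fin.succ_ne_zero _).symm ?_ ?_ ?_ m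
    · simp [h, hΔ]
    · simp
    · simp

theorem optRegret_roundRobin (hΔ : 0 < Δ) (π : Policy (n + 2) (k + 2)) (i : Fin (n + 2)) :
    optRegret π (roundRobin n k T) (duelMeans Δ A) i =
      ∑ t with i ∈ (roundRobin n k T t).players, (value (duelMeans Δ A) i (stableMatching A t i) -
        expReward π (roundRobin n k T) (duelMeans Δ A) i t) := by
  unfold optRegret
  simp only [Round.playerOptimal_eq (roundRobin_isStable_iff (A := A) hΔ _)]

theorem pessRegret_roundRobin (hΔ : 0 < Δ) (π : Policy (n + 2) (k + 2)) (i : Fin (n + 2)) :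
    pessRegret π (roundRobin n k T) (duelMeans Δ A) i =
      optRegret π (roundRobin n k T) (duelMeans Δ A) i := by
  rw [optRegret_roundRobin hΔ]
  unfold pessRegret
  simp only [Round.playerPessimal_eq (roundRobin_isStable_iff (A := A) hΔ _)]

theorem le_sub_expReward {N K : ℕ} {π : Policy N K} {E : Env N K T} {μ : Fin N → Fin K → ℝ}
    (hμ : ∀ i j, μ i j ∈ Set.Ioo (0 : ℝ) 1) {i : Fin N} {t : Fin T} {v : ℝ} {g : Matching N K → ℝ}
    (h : ∀ m, (E t).Feasible m → g m ≤ v - value μ i (m i)) :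
    ∑ ω, trajProb π E μ ω * g (ω t).1 ≤ v - expReward π E μ i t := by
  have hv : v = ∑ ω, trajProb π E μ ω * v := by rw [← Finset.sum_mul, sum_trajProb, one_mul]
  rw [expReward_eq, hv, ← Finset.sum_sub_distrib]
  refine Finset.sum_le_sum fun ω _ => ?_
  rw [← mul_sub]
  by_cases h0 : trajProb π E μ ω = 0
  · simp [h0]
  · exact mul_le_mul_of_nonneg_left (h _ (feasible_of_trajProb_ne_zero h0 t))
      (trajProb_nonneg π E (fun i j => (hμ i j).1.le) (fun i j => (hμ i j).2.le) ω)

/-- The rounds in which the exploring player `i` meets the risky arm `j`. -/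
def meetings (n k T : ℕ) (i : Fin (n + 1)) (j : Fin (k + 1)) : Finset (Fin T) :=
  Finset.univ.filter fun t => explorer n t = i ∧ riskyArm n k t = j

/-- When the risky arm `j` is the better one for player `i`, avoiding it is costly for `i`. -/
theorem le_optRegret_explorer (hΔ : 0 < Δ) (hΔ' : Δ ≤ 1 / 8) (π : Policy (n + 2) (k + 2))
    (i : Fin (n + 1)) (j : Fin (k + 1)) :
    Δ * ∑ t ∈ meetings n k T i j,
        (1 - pullProb π (roundRobin n k T) (duelMeans Δ {(i, j)}) i.castSucc j.succ t) ≤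
      optRegret π (roundRobin n k T) (duelMeans Δ {(i, j)}) i.castSucc := by
  have hμ := duelMeans_mem_Ioo (A := {(i, j)}) hΔ hΔ'
  rw [optRegret_roundRobin hΔ, Finset.mul_sum]
  refine (Finset.sum_le_sum (g := fun t : Fin T => value (duelMeans Δ {(i, j)}) i.castSucc
    (stableMatching {(i, j)} t i.castSucc) -
      expReward π (roundRobin n k T) (duelMeans Δ {(i, j)}) i.castSucc t) ?_).trans
    (Finset.sum_le_sum_of_subset_of_nonneg ?_ ?_)
  · intro t ht
    obtain ⟨hi, hj⟩ := (Finset.mem_filter.1 ht).2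
    have h1 : Δ * (1 - pullProb π (roundRobin n k T) (duelMeans Δ {(i, j)}) i.castSucc j.succ t) =
        ∑ ω, trajProb π (roundRobin n k T) (duelMeans Δ {(i, j)}) ω *
          (Δ * (1 - if (ω t).1 i.castSucc = some j.succ then 1 else 0)) := by
      have : ∀ p x : ℝ, p * (Δ * (1 - x)) = Δ * p - Δ * (p * x) := fun p x => by ring
      simp only [this, Finset.sum_sub_distrib, ← Finset.mul_sum, sum_trajProb, pullProb]
      ring
    rw [h1]
    refine le_sub_expReward (g := fun m => Δ * (1 - if m i.castSucc = some j.succ then 1 else 0))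
      hμ fun m hm => ?_
    have hst : stableMatching {(i, j)} t i.castSucc = some j.succ := by
      simp [stableMatching, hi, hj, duelMatching]
    rcases duel_feasible_cases hm i.castSucc with h | h | h
    · simp only [hst, h, value, Option.elim_some, Option.elim_none, duelMeans_castSucc_succ]
      simp
    · simp only [hst, h, value, Option.elim_some, duelMeans_castSucc_succ, duelMeans_castSucc_zero]
      simp [(Fin.succ_ne_zero j).symm]
    · rw [hj] at h
      simp [hst, h, value]
  · intro t ht
    obtain ⟨hi, hj⟩ := (Finset.mem_filter.1 ht).2
    simp [roundRobin, duel, hi]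
  · intro t ht hmeet
    have hi : explorer n t = i := by
      simpa [roundRobin, duel, (Fin.castSucc_lt_last i).ne, eq_comm] using ht
    have hj : riskyArm n k t ≠ j := fun hj => hmeet (by simp [meetings, hi, hj])
    have hst : stableMatching {(i, j)} t i.castSucc = some 0 := by
      simp [stableMatching, hi, hj, duelMatching]
    refine le_trans ?_ (le_sub_expReward (g := fun _ => 0) hμ fun m hm => ?_)
    · simp
    · rcases duel_feasible_cases hm i.castSucc with h | h | h
      · simp [hst, h, value]
      · simp [hst, h, value]
      · simp [hst, h, value, hj, hΔ.le]

/-- Each assignment of an exploring player to a risky arm costs the last player `1 / 2`. -/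
theorem le_optRegret_last (hΔ : 0 < Δ) (hΔ' : Δ ≤ 1 / 8) (π : Policy (n + 2) (k + 2)) :
    (∑ i : Fin (n + 1), ∑ j : Fin (k + 1), ∑ t,
        pullProb π (roundRobin n k T) (duelMeans Δ ∅) i.castSucc j.succ t) / 2 ≤
      optRegret π (roundRobin n k T) (duelMeans Δ ∅) (Fin.last (n + 1)) := by
  have hμ := duelMeans_mem_Ioo (n := n) (k := k) (A := ∅) hΔ hΔ'
  have hswap : (∑ i : Fin (n + 1), ∑ j : Fin (k + 1), ∑ t,
        pullProb π (roundRobin n k T) (duelMeans Δ ∅) i.castSucc j.succ t) / 2 =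
      ∑ t, ∑ ω, trajProb π (roundRobin n k T) (duelMeans Δ ∅) ω *
        ((∑ i : Fin (n + 1), ∑ j : Fin (k + 1),
          if (ω t).1 i.castSucc = some j.succ then 1 else 0) / 2) := by
    simp only [pullProb, mul_div_assoc', ← Finset.sum_div]
    congr 1
    rw [Finset.sum_congr rfl fun i _ => Finset.sum_comm, Finset.sum_comm]
    refine Finset.sum_congr rfl fun t _ => ?_
    rw [Finset.sum_congr rfl fun i _ => Finset.sum_comm, Finset.sum_comm]
    simp only [Finset.mul_sum]
  rw [hswap, optRegret_roundRobin hΔ, Finset.filter_true_of_mem fun t _ => by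
    simp [roundRobin, duel]]
  refine Finset.sum_le_sum fun t _ => le_sub_expReward (g := fun m =>
    (∑ i : Fin (n + 1), ∑ j : Fin (k + 1), if m i.castSucc = some j.succ then 1 else 0) / 2)
    hμ fun m hm => ?_
  have hst : stableMatching ∅ t (Fin.last (n + 1)) = some (riskyArm n k t).succ := by
    simp [stableMatching, duelMatching, (Fin.castSucc_lt_last _).ne']
  rw [hst]
  have hcount : (∑ i : Fin (n + 1), ∑ j : Fin (k + 1),
      if m i.castSucc = some j.succ then (1 : ℝ) else 0) =
      if m (explorer n t).castSucc = some (riskyArm n k t).succ then 1 else 0 := by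
    rw [Finset.sum_eq_single (explorer n t), Finset.sum_eq_single (riskyArm n k t)]
    · intro j _ hj
      rw [if_neg]
      intro h
      have := hm.2.1 _ _ h
      simp [roundRobin, duel, hj] at this
    · simp
    · intro i _ hi
      refine Finset.sum_eq_zero fun j _ => ?_
      rw [hm.1 i.castSucc (by simp [roundRobin, duel, hi, (Fin.castSucc_lt_last i).ne])]
      simp
    · simp
  rw [hcount]
  split_ifs with h
  · rcases duel_feasible_cases hm (Fin.last (n + 1)) with h' | h' | h'
    · simp [h', value]; norm_num
    · simp [h', value]; norm_num
    · exact absurd (duel_feasible_eq hm h h') (Fin.castSucc_lt_last _).ne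
  · rcases duel_feasible_cases hm (Fin.last (n + 1)) with h' | h' | h'
    · simp [h', value]; norm_num
    · simp [h', value]; norm_num
    · simp [h', value]

end HardInstance

section Counting

variable {n k T : ℕ}

theorem div_le_card_meetings (i : Fin (n + 1)) (j : Fin (k + 1)) :
    T / ((n + 1) * (k + 1)) ≤ (meetings n k T i j).card := by
  have hlt : ∀ q : Fin (T / ((n + 1) * (k + 1))),
      ((q : ℕ) * (k + 1) + j) * (n + 1) + i < T := fun q => by
    have h1 : ((q : ℕ) + 1) * ((n + 1) * (k + 1)) ≤ T :=
      (Nat.mul_le_mul_right _ q.2).trans (Nat.div_mul_le_self T _)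
    have h2 : ((j : ℕ) + 1) * (n + 1) ≤ (k + 1) * (n + 1) := Nat.mul_le_mul_right _ j.2
    have h3 := i.2
    nlinarith
  have := Finset.card_le_card_of_injOn (s := Finset.univ) (t := meetings n k T i j)
    (fun q : Fin (T / ((n + 1) * (k + 1))) =>
      (⟨((q : ℕ) * (k + 1) + j) * (n + 1) + i, hlt q⟩ : Fin T)) ?_ ?_
  · simpa using this
  · intro q _
    have hj : (((q : ℕ) * (k + 1) + j) * (n + 1) + i) / (n + 1) = (q : ℕ) * (k + 1) + j := by
      rw [mul_comm _ (n + 1), Nat.mul_add_div (Nat.succ_pos n), Nat.div_eq_of_lt i.2, add_zero]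
    simp only [meetings, Finset.coe_filter, Finset.mem_univ, true_and, Set.mem_ofPred_eq]
    constructor
    · ext
      simp [explorer, Fin.ofNat, Nat.mod_eq_of_lt i.2]
    · ext
      simp [riskyArm, Fin.ofNat, hj, Nat.mod_eq_of_lt j.2]
  · intro q _ q' _ h
    have h1 := Nat.add_right_cancel (Fin.mk.inj h)
    have h2 := Nat.add_right_cancel (Nat.eq_of_mul_eq_mul_right (Nat.succ_pos n) h1)
    exact Fin.ext (Nat.eq_of_mul_eq_mul_right (Nat.succ_pos k) h2)

theorem roundsOf_le {N K : ℕ} (E : Env N K T) (i : Fin N) : E.roundsOf i ≤ T :=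
  (Finset.card_filter_le _ _).trans (by simp)

theorem roundsOf_last : (roundRobin n k T).roundsOf (Fin.last (n + 1)) = T := by
  simp [Env.roundsOf, roundRobin, duel]

theorem div_le_roundsOf (i : Fin (n + 2)) : T / (n + 1) ≤ (roundRobin n k T).roundsOf i := by
  induction i using Fin.lastCases with
  | last => rw [roundsOf_last]; exact Nat.div_le_self _ _
  | cast i =>
    have h := div_le_card_meetings (T := T) (k := 0) i 0
    rw [show (n + 1) * (0 + 1) = n + 1 from mul_one _] at h
    refine h.trans (Finset.card_le_card fun t ht => ?_)
    have hi := (Finset.mem_filter.1 ht).2.1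
    simp [roundRobin, duel, hi]

end Counting

section Growth

variable {n : ℕ} {k : ℕ → ℕ}

theorem le_mul_roundsOf {T : ℕ} (hT : n + 1 ≤ T) (i : Fin (n + 2)) :
    T ≤ 2 * (n + 1) * (roundRobin n (k T) T).roundsOf i := by
  have h1 := div_le_roundsOf (k := k T) (T := T) i
  have h2 := Nat.lt_div_mul_add (a := T) (Nat.succ_pos n)
  have h3 : 1 ≤ T / (n + 1) := (Nat.one_le_div_iff (Nat.succ_pos n)).2 hT
  have h4 := Nat.mul_le_mul_left (2 * (n + 1)) h1
  have h5 := Nat.mul_le_mul_right (n + 1) h3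
  simp only [Nat.succ_eq_add_one] at h2
  nlinarith

theorem admissible_roundRobin
    (hk : (fun T => ((k T + 2 : ℕ) : ℝ)) =O[atTop] fun T : ℕ => Real.log T) :
    Admissible (K := fun T => k T + 2) fun T => roundRobin n (k T) T := by
  have htend : ∀ i, Tendsto (fun T => (roundRobin n (k T) T).roundsOf i) atTop atTop := fun i =>
    tendsto_atTop_mono (fun T => div_le_roundsOf i)
      (Nat.tendsto_div_const_atTop (Nat.succ_ne_zero n))
  refine ⟨htend, ⟨2 * (n + 1), ?_⟩, fun i => hk.trans ?_⟩
  · filter_upwards [eventually_ge_atTop (n + 1)] with T hT i j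
    have h : ((roundRobin n (k T) T).roundsOf i : ℝ) ≤ T := by exact_mod_cast roundsOf_le _ i
    refine h.trans ?_
    exact_mod_cast le_mul_roundsOf (k := k) hT j
  · refine IsBigO.of_bound 2 ?_
    filter_upwards [eventually_ge_atTop (n + 1), (htend i).eventually_ge_atTop (2 * (n + 1))]
      with T hT hr
    set r := (roundRobin n (k T) T).roundsOf i
    have hTr : (T : ℝ) ≤ (r : ℝ) ^ 2 := by
      exact_mod_cast (le_mul_roundsOf (k := k) hT i).trans
        ((Nat.mul_le_mul_right r hr).trans (sq r).ge)
    have hT0 : (0 : ℝ) < T := by exact_mod_cast (Nat.succ_pos n).trans_le hT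
    rw [Real.norm_of_nonneg (Real.log_natCast_nonneg T),
      Real.norm_of_nonneg (Real.log_natCast_nonneg r)]
    calc Real.log T ≤ Real.log ((r : ℝ) ^ 2) := Real.log_le_log hT0 hTr
      _ = 2 * Real.log r := by rw [Real.log_pow]; norm_num

theorem isInstance_roundRobin
    (hk : (fun T => ((k T + 2 : ℕ) : ℝ)) =O[atTop] fun T : ℕ => Real.log T)
    {Δ : ℝ} (hΔ : 0 < Δ) (hΔ' : Δ ≤ 1 / 8) (A : ∀ T, Finset (Fin (n + 1) × Fin (k T + 1))) :
    IsInstance (K := fun T => k T + 2) (fun T => roundRobin n (k T) T)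
      fun T => duelMeans Δ (A T) :=
  ⟨admissible_roundRobin hk, fun _ => validMeans_duelMeans hΔ hΔ', _,
    fun _ => duelMeans_cases⟩

theorem isLittleO_log_mul {b c D s : ℝ} (hc : 0 ≤ c) (hcs : c < s) :
    (fun x : ℝ => Real.log x * (b * Real.log x + D * x ^ c + 1)) =o[atTop] fun x => x ^ s := by
  have hd : 0 < (s - c) / 2 := by linarith
  have h1 : (fun x : ℝ => b * Real.log x + D * x ^ c + 1) =O[atTop]
      fun x => x ^ (c + (s - c) / 2) := by
    refine (((isLittleO_log_rpow_atTop (by linarith)).isBigO.const_mul_left b).add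
      (IsBigO.const_mul_left ?_ D)).add ?_
    · refine IsBigO.of_bound 1 ?_
      filter_upwards [eventually_ge_atTop (1 : ℝ)] with x hx
      have hx0 : (0 : ℝ) ≤ x := zero_le_one.trans hx
      rw [Real.norm_of_nonneg (Real.rpow_nonneg hx0 _), Real.norm_of_nonneg (Real.rpow_nonneg hx0 _),
        one_mul]
      exact Real.rpow_le_rpow_of_exponent_le hx (by linarith)
    · refine IsBigO.of_bound 1 ?_
      filter_upwards [eventually_ge_atTop (1 : ℝ)] with x hx
      have hx0 : (0 : ℝ) ≤ x := zero_le_one.trans hx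
      rw [Real.norm_of_nonneg (Real.rpow_nonneg hx0 _), norm_one, one_mul]
      exact Real.one_le_rpow hx (by linarith)
  refine ((isLittleO_log_rpow_atTop hd).mul_isBigO h1).congr' EventuallyEq.rfl ?_
  filter_upwards [eventually_gt_atTop (0 : ℝ)] with x hx
  rw [← Real.rpow_add hx]
  ring_nf

theorem eventually_lt_mul_div
    (hk : (fun T => ((k T + 2 : ℕ) : ℝ)) =O[atTop] fun T : ℕ => Real.log T)
    {b c D δ : ℝ} (hc : 0 ≤ c) (hδ : 0 ≤ δ) (hcδ : c + δ < 1) :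
    ∀ᶠ T : ℕ in atTop, b * Real.log T + D * (T : ℝ) ^ c <
      Real.exp (-(δ * Real.log T)) / 2 * (T / ((n + 1) * (k T + 1)) : ℕ) := by
  obtain ⟨C, hC, hkC⟩ := hk.exists_pos
  have ho := (isLittleO_log_mul (b := b) (D := D) hc (by linarith : c < 1 - δ)).comp_tendsto
    tendsto_natCast_atTop_atTop
  have hε : 0 < 1 / (4 * (n + 1) * C) := by positivity
  filter_upwards [hkC.bound, ho.bound hε, eventually_ge_atTop 2] with T h1 h2 hT
  have hT1 : (1 : ℝ) < T := by exact_mod_cast hT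
  have hT0 : (0 : ℝ) < T := zero_lt_one.trans hT1
  have hlog : 0 < Real.log T := Real.log_pos hT1
  rw [Real.norm_of_nonneg (Nat.cast_nonneg _), Real.norm_of_nonneg hlog.le] at h1
  simp only [Function.comp_apply] at h2
  rw [Real.norm_of_nonneg (Real.rpow_nonneg hT0.le (1 - δ))] at h2
  replace h2 := (le_abs_self _).trans h2
  set d : ℕ := (n + 1) * (k T + 1) with hd
  have hd0 : (0 : ℝ) < d := by positivity
  have hdC : (d : ℝ) ≤ (n + 1) * C * Real.log T := by
    have : (d : ℝ) ≤ (n + 1) * ((k T + 2 : ℕ) : ℝ) := by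
      rw [hd]; push_cast; nlinarith [(Nat.cast_nonneg n : (0 : ℝ) ≤ n)]
    rw [mul_assoc]
    exact this.trans (mul_le_mul_of_nonneg_left h1 (by positivity))
  have hfloor : (T : ℝ) / d - 1 ≤ (T / d : ℕ) := by
    have := Nat.lt_div_mul_add (a := T) (b := d) (by positivity)
    rw [sub_le_iff_le_add, div_le_iff₀ hd0]
    have h : (T : ℝ) ≤ (T / d : ℕ) * d + d := by exact_mod_cast this.le
    linarith
  have hexp : Real.exp (-(δ * Real.log T)) = (T : ℝ) ^ (-δ) := by
    rw [Real.rpow_def_of_pos hT0]; ring_nf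
  have hle1 : (T : ℝ) ^ (-δ) ≤ 1 :=
    Real.rpow_le_one_of_one_le_of_nonpos hT1.le (by linarith)
  have hpos : 0 < (T : ℝ) ^ (-δ) := Real.rpow_pos_of_pos hT0 _
  have hsplit : (T : ℝ) ^ (1 - δ) = (T : ℝ) ^ (-δ) * T := by
    rw [sub_eq_neg_add, Real.rpow_add hT0, Real.rpow_one]
  have hpow : 0 < (T : ℝ) ^ (1 - δ) := Real.rpow_pos_of_pos hT0 _
  have hmain : b * Real.log T + D * (T : ℝ) ^ c + 1 ≤ (T : ℝ) ^ (1 - δ) / (4 * d) := by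
    have h3 : b * Real.log T + D * (T : ℝ) ^ c + 1 ≤
        (T : ℝ) ^ (1 - δ) / (4 * ((n + 1) * C * Real.log T)) := by
      rw [le_div_iff₀ (by positivity)]
      rw [div_mul_eq_mul_div, one_mul, le_div_iff₀ (by positivity)] at h2
      linarith
    refine h3.trans (div_le_div_of_nonneg_left hpow.le (by positivity) ?_)
    linarith
  have hquot : (T : ℝ) ^ (1 - δ) / (4 * d) = (T : ℝ) ^ (-δ) * (T / d) / 4 := by
    rw [hsplit]; field_simp
  rw [hexp]
  have hstep := mul_le_mul_of_nonneg_left hfloor hpos.le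
  have hnn : 0 < (T : ℝ) ^ (-δ) * (T / d) := by positivity
  rw [hquot] at hmain
  linarith

end Growth

section LowerBound

variable {n : ℕ} {k : ℕ → ℕ}

/-- A consistent policy assigns each exploring player to each risky arm logarithmically often,
uniformly over the arms. -/
theorem eventually_le_sum_pullProb {α : ℝ} (hα0 : 0 ≤ α) (hα1 : α < 1)
    (hk : (fun T => ((k T + 2 : ℕ) : ℝ)) =O[atTop] fun T : ℕ => Real.log T)
    (π : ∀ T, Policy (n + 2) (k T + 2)) (hπ : IsConsistent (K := fun T => k T + 2) α π)
    {Δ : ℝ} (hΔ : 0 < Δ) (hΔ' : Δ ≤ 1 / 8) (i : Fin (n + 1)) :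
    ∀ᶠ T : ℕ in atTop, ∀ j : Fin (k T + 1), (1 - α) / (72 * Δ ^ 2) * Real.log T ≤
      ∑ t, pullProb (π T) (roundRobin n (k T) T) (duelMeans Δ ∅) i.castSucc j.succ t := by
  choose j hj using fun T => Finite.exists_min fun j : Fin (k T + 1) =>
    ∑ t, pullProb (π T) (roundRobin n (k T) T) (duelMeans Δ ∅) i.castSucc j.succ t
  set c : ℝ := (1 + α) / 2 with hc
  have hregret : ∀ᶠ T : ℕ in atTop,
      optRegret (π T) (roundRobin n (k T) T) (duelMeans Δ {(i, j T)}) i.castSucc ≤ (T : ℝ) ^ c := by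
    have h := hπ _ _ (isInstance_roundRobin (n := n) hk hΔ hΔ' fun T => {(i, j T)}) c
      (by rw [hc]; linarith) i.castSucc
    simp only [pessRegret_roundRobin hΔ, or_self] at h
    filter_upwards [h 1 one_pos] with T hT
    rw [one_mul] at hT
    exact hT.trans (Real.rpow_le_rpow (Nat.cast_nonneg _)
      (by exact_mod_cast roundsOf_le _ _) (by rw [hc]; linarith))
  filter_upwards [hregret, eventually_lt_mul_div (n := n) hk (b := (1 - α) / (72 * Δ ^ 2)) (c := c)
    (D := 1 / Δ) (δ := (1 - α) / 4) (by rw [hc]; linarith) (by linarith) (by rw [hc]; linarith)]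
    with T hT hgrow j'
  refine le_trans ?_ (hj T j')
  by_contra! hlt
  set P := ∑ t, pullProb (π T) (roundRobin n (k T) T) (duelMeans Δ ∅) i.castSucc (j T).succ t
    with hP
  have hμ := duelMeans_mem_Ioo (n := n) (k := k T) (A := ∅) hΔ hΔ'
  have hP0 : 0 ≤ P := Finset.sum_nonneg fun t _ =>
    pullProb_nonneg _ _ (fun i j => (hμ i j).1.le) (fun i j => (hμ i j).2.le) _ _ t
  have hcom := change_of_measure (π T) (roundRobin n (k T) T) (μ := duelMeans Δ ∅)
    (μ' := duelMeans Δ {(i, j T)}) i.castSucc (j T).succ hμ (duelMeans_mem_Ioo hΔ hΔ' _ _) ?_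
    (meetings n (k T) T i (j T))
  · simp only [duelMeans_castSucc_succ, Finset.notMem_empty, if_false, Finset.mem_singleton,
      if_true, ← hP] at hcom
    have hcoef : (1 / 2 - Δ - (1 / 2 + Δ)) ^ 2 / ((1 / 2 + Δ) * (1 - (1 / 2 + Δ))) ≤
        18 * Δ ^ 2 := by
      rw [div_le_iff₀ (by nlinarith)]
      have h : (2 : ℝ) / 9 ≤ (1 / 2 + Δ) * (1 - (1 / 2 + Δ)) := by nlinarith
      nlinarith [mul_le_mul_of_nonneg_left h (by positivity : 0 ≤ 18 * Δ ^ 2)]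
    have hexp : Real.exp (-((1 - α) / 4 * Real.log T)) ≤
        Real.exp (-((1 / 2 - Δ - (1 / 2 + Δ)) ^ 2 / ((1 / 2 + Δ) * (1 - (1 / 2 + Δ))) * P)) := by
      refine Real.exp_le_exp.2 (neg_le_neg ((mul_le_mul_of_nonneg_right hcoef hP0).trans ?_))
      refine (mul_le_mul_of_nonneg_left hlt.le (by positivity)).trans (le_of_eq ?_)
      field_simp
      ring
    have hcard : ((T / ((n + 1) * (k T + 1)) : ℕ) : ℝ) ≤ (meetings n (k T) T i (j T)).card := by
      exact_mod_cast div_le_card_meetings i (j T)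
    have hlow := mul_le_mul (div_le_div_of_nonneg_right hexp zero_le_two) hcard
      (Nat.cast_nonneg _) (by positivity)
    have hup := (le_optRegret_explorer hΔ hΔ' (π T) i (j T)).trans hT
    rw [mul_comm, ← le_div_iff₀ hΔ, div_eq_mul_one_div, mul_comm] at hup
    linarith
  · intro i' j' hne
    induction i' using Fin.lastCases with
    | last => induction j' using Fin.cases <;> simp
    | cast i' =>
      induction j' using Fin.cases with
      | zero => simp
      | succ j' =>
        have : (i', j') ≠ (i, j T) := fun h => hne (by simp_all)
        rw [duelMeans_castSucc_succ, duelMeans_castSucc_succ,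
          if_neg (by simpa using this), if_neg (Finset.notMem_empty _)]

theorem eventually_le_pessRegret_last {α : ℝ} (hα0 : 0 ≤ α) (hα1 : α < 1)
    (hk : (fun T => ((k T + 2 : ℕ) : ℝ)) =O[atTop] fun T : ℕ => Real.log T)
    (π : ∀ T, Policy (n + 2) (k T + 2)) (hπ : IsConsistent (K := fun T => k T + 2) α π)
    {Δ : ℝ} (hΔ : 0 < Δ) (hΔ' : Δ ≤ 1 / 8) :
    ∀ᶠ T : ℕ in atTop,
      (n + 1) * ((k T + 1) * ((1 - α) / (72 * Δ ^ 2) * Real.log T)) / 2 ≤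
      pessRegret (π T) (roundRobin n (k T) T) (duelMeans Δ ∅) (Fin.last (n + 1)) := by
  filter_upwards [eventually_all.2 fun i =>
    eventually_le_sum_pullProb hα0 hα1 hk π hπ hΔ hΔ' i] with T hT
  rw [pessRegret_roundRobin hΔ]
  refine le_trans ?_ (le_optRegret_last hΔ hΔ' (π T))
  refine div_le_div_of_nonneg_right ?_ zero_le_two
  have := Finset.sum_le_sum fun i (_ : i ∈ Finset.univ) =>
    Finset.sum_le_sum fun j (_ : j ∈ Finset.univ) => hT i j
  simpa using this

end LowerBound

end SleepingBandits

theorem theorem2 (α : ℝ) (hα0 : 0 ≤ α) (hα1 : α < 1) :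
    ∃ κ : ℝ, 0 < κ ∧
      ∀ (N : ℕ) (K : ℕ → ℕ), 2 ≤ N → (∀ T, N ≤ K T) →
        ((fun T => (K T : ℝ)) =O[atTop] fun T : ℕ => Real.log T) →
      ∀ π : ∀ T, SleepingBandits.Policy N (K T), SleepingBandits.IsConsistent α π →
      ∀ Δ : ℝ, 0 < Δ → 4 * N * Δ ≤ 1 →
        ∃ (E : ∀ T, SleepingBandits.Env N (K T) T) (μ : ∀ T, Fin N → Fin (K T) → ℝ),
          SleepingBandits.IsInstance E μ ∧
          (∀ T ≥ 1, IsLeast (SleepingBandits.gaps (E T) (μ T)) Δ) ∧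
          ∃ i : Fin N,
            (∀ T, SleepingBandits.pessRegret (π T) (E T) (μ T) i ≤
              SleepingBandits.optRegret (π T) (E T) (μ T) i) ∧
            ∀ᶠ T in atTop,
              κ * (N * ((K T : ℝ) - N + 1) * Real.log ((E T).roundsOf i) / Δ ^ 2) ≤
                SleepingBandits.pessRegret (π T) (E T) (μ T) i := by
  refine ⟨(1 - α) / 288, by linarith, fun N K hN hNK hK π hπ Δ hΔ hNΔ => ?_⟩
  obtain ⟨n, rfl⟩ := Nat.exists_eq_add_of_le' hN
  obtain ⟨k, rfl⟩ : ∃ k : ℕ → ℕ, K = fun T => k T + 2 :=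
    ⟨fun T => K T - 2, funext fun T => (Nat.sub_add_cancel (hN.trans (hNK T))).symm⟩
  have hn : (0 : ℝ) ≤ n := Nat.cast_nonneg n
  have hΔ' : Δ ≤ 1 / 8 := by
    push_cast at hNΔ
    nlinarith [mul_nonneg hn hΔ.le]
  refine ⟨fun T => SleepingBandits.roundRobin n (k T) T,
    fun T => SleepingBandits.duelMeans Δ ∅,
    SleepingBandits.isInstance_roundRobin hK hΔ hΔ' fun _ => ∅,
    fun T hT => SleepingBandits.isLeast_gaps hΔ hΔ' hT, Fin.last (n + 1),
    fun T => (SleepingBandits.pessRegret_roundRobin hΔ (π T) _).le, ?_⟩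
  filter_upwards [SleepingBandits.eventually_le_pessRegret_last hα0 hα1 hK π hπ hΔ hΔ'] with T hT
  refine le_trans ?_ hT
  rw [SleepingBandits.roundsOf_last]
  have hL : 0 ≤ (1 - α) / Δ ^ 2 * Real.log T :=
    mul_nonneg (div_nonneg (by linarith) (by positivity)) (Real.log_natCast_nonneg T)
  have hsize : ((n + 2 : ℕ) : ℝ) * (((k T + 2 : ℕ) : ℝ) - (n + 2 : ℕ) + 1) ≤
      2 * ((n + 1) * (k T + 1)) := by
    push_cast
    have hk : (n : ℝ) ≤ k T := by exact_mod_cast Nat.le_of_add_le_add_right (hNK T)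
    nlinarith
  have := mul_le_mul_of_nonneg_right hsize hL
  calc _ = ((n + 2 : ℕ) : ℝ) * (((k T + 2 : ℕ) : ℝ) - (n + 2 : ℕ) + 1) *
        ((1 - α) / Δ ^ 2 * Real.log T) / 288 := by ring
    _ ≤ 2 * ((n + 1) * (k T + 1)) * ((1 - α) / Δ ^ 2 * Real.log T) / 288 := by linarith
    _ = _ := by field_simp; ring
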